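/- Let $n=2^{k_0}+2^{k_1}+\dots+2^{k_m}$ with $0\le k_0<k_1<\dots<k_m$, and let $0\le i\le m$ with $k_i>2$. For a group $G$ let $Syl_2\,G$ denote a Sylow $2$-subgroup of $G$. For permutation groups $G_1\le S_{\Omega_1},\dots,G_r\le S_{\Omega_r}$ on finite sets, let the even subdirect product $G_1\boxtimes\dots\boxtimes G_r$ be the subgroup of $G_1\times\dots\times G_r$ consisting of all $(g_1,\dots,g_r)$ with $\operatorname{sgn}(g_1)\cdots\operatorname{sgn}(g_r)=1$, i.e. those tuples that induce an even permutation of the disjoint union $\Omega_1\sqcup\dots\sqcup\Omega_r$. Theorem. Let $P=Syl_2A_n$ be any Sylow $2$-subgroup of $A_n$. Then $P$ has exactly one orbit $O$ on $\{1,\dots,n\}$ with $2^{k_i}$ elements. Extending permutations by the identity outside $O$, so that $Alt(O)\cong A_{2^{k_i}}$ becomes a subgroup of $A_n$, the group $P$ contains a Sylow $2$-subgroup $T=Syl_2A_{2^{k_i}}$ of $Alt(O)$, and for every such $T\le P$ the centralizer of $T$ in $P$ satisfies $$C_{P}(T)\;\cong\; Syl_2S_{2^{k_0}}\boxtimes\dots\boxtimes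 Syl_2S_{2^{k_{i-1}}}\boxtimes Syl_2S_{2^{k_{i+1}}}\boxtimes\dots\boxtimes Syl_2S_{2^{k_m}}\boxtimes Z(Syl_2S_{2^{k_i}}),$$ where each $Syl_2S_{2^{k_j}}$ (for $j\neq i$) and $Z(Syl_2S_{2^{k_i}})$ is regarded as a permutation group on $2^{k_j}$, respectively $2^{k_i}$, points. -/

import Mathlib

/-- The even subdirect product `⊠ j, G j` of a finite family of permutation groups
`G j ≤ Sym (Ω j)`: the subgroup of the direct product `∏ j, G j` formed by the tuples that act on
the disjoint union of the sets `Ω j` by an even permutation, that is, the tuples whose number of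
odd components is even. -/
def evenSubdirectProduct {ι : Type*} [Fintype ι] {Ω : ι → Type*} [∀ j, Fintype (Ω j)]
    [∀ j, DecidableEq (Ω j)] (G : ∀ j, Subgroup (Equiv.Perm (Ω j))) : Subgroup (∀ j, G j) where
  carrier := {g | ∏ j, Equiv.Perm.sign (g j : Equiv.Perm (Ω j)) = 1}
  one_mem' := by simp
  mul_mem' := by
    intro a b ha hb
    simp only [Set.mem_setOf_eq] at ha hb ⊢
    simp [Finset.prod_mul_distrib, ha, hb]
  inv_mem' := by
    intro a ha
    simp only [Set.mem_setOf_eq] at ha ⊢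
    simpa using ha

/-! The exponents being distinct, Legendre's formula shows that the 2-part of n! is the product of
the 2-parts of the (2^k_j)!. Hence a Sylow 2-subgroup of S_n is, for a suitable partition into
blocks, the product of the Q_j, and P is its even part. The orbits of P are the blocks: an odd
element of the product moving one point to another in its block is made even by a transposition
fixing the first point. The sizes are distinct, so O is the block of index i. By maximality, T is
the full group of elements of P supported on O, that is, the even part of Q_i. Commuting with T
constrains only the component at i. The crux, `commute_of_forall_even_commute`, is that centralizing
the even part of Q_i already means centralizing Q_i once k_i > 2. So that component runs over
Z(Q_i), the others are free, and evenness of the whole tuple is the condition defining ⊠. -/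

theorem Nat.sum_two_pow_div (s : Finset ℕ) (i : ℕ) :
    (∑ a ∈ s, 2 ^ a) / 2 ^ i = ∑ a ∈ s, 2 ^ a / 2 ^ i := by
  -- No carry occurs: the terms below 2^i sum to less than 2^i, and the others are multiples of it.
  have hlt : ∑ a ∈ s with a < i, 2 ^ a < 2 ^ i :=
    Nat.geomSum_lt le_rfl (by simp)
  have hge : ∑ a ∈ s with ¬ a < i, 2 ^ a = 2 ^ i * ∑ a ∈ s with ¬ a < i, 2 ^ a / 2 ^ i := by
    rw [Finset.mul_sum]
    refine Finset.sum_congr rfl fun a ha => ?_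
    rw [Nat.mul_div_cancel' (pow_dvd_pow 2 (not_lt.mp (Finset.mem_filter.mp ha).2))]
  have hzero : ∑ a ∈ s with a < i, 2 ^ a / 2 ^ i = 0 :=
    Finset.sum_eq_zero fun a ha =>
      Nat.div_eq_of_lt (Nat.pow_lt_pow_right one_lt_two (Finset.mem_filter.mp ha).2)
  rw [← Finset.sum_filter_add_sum_filter_not s (· < i), hge,
    Nat.add_mul_div_left _ _ (by positivity), Nat.div_eq_of_lt hlt,
    ← Finset.sum_filter_add_sum_filter_not s (· < i) (fun a => 2 ^ a / 2 ^ i), hzero]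

/-- Legendre's formula, each floor being additive over distinct powers of 2. The bound `b` serves
all the factorials at once, so the two sums can be exchanged. -/
theorem padicValNat_two_factorial_sum_two_pow (s : Finset ℕ) :
    padicValNat 2 (∑ a ∈ s, 2 ^ a).factorial = ∑ a ∈ s, padicValNat 2 (2 ^ a).factorial := by
  set b := Nat.log 2 (∑ a ∈ s, 2 ^ a) + 1
  have hb : ∀ a ∈ s, Nat.log 2 (2 ^ a) < b := fun a ha =>
    Nat.lt_succ_of_le (Nat.log_mono_right
      (Finset.single_le_sum (f := fun a => 2 ^ a) (fun _ _ => Nat.zero_le _) ha))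
  rw [padicValNat_factorial (Nat.lt_succ_self _),
    Finset.sum_congr rfl fun a ha => padicValNat_factorial (hb a ha), Finset.sum_comm]
  exact Finset.sum_congr rfl fun i _ => Nat.sum_two_pow_div s i

namespace Equiv.Perm

open Equiv

/-! ### Permutations preserving each block, and their signs -/

section Blocks

variable {ι α : Type*} {Ω : ι → Type*}

/-- The action on `α` of a tuple of permutations of the blocks of a partition `e` of `α`. -/
def ofBlocks (e : (Σ j, Ω j) ≃ α) : (∀ j, Perm (Ω j)) →* Perm α :=
  e.permCongrHom.toMonoidHom.comp (sigmaCongrRightHom Ω)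

@[simp]
theorem ofBlocks_apply (e : (Σ j, Ω j) ≃ α) (g : ∀ j, Perm (Ω j)) (j : ι) (x : Ω j) :
    ofBlocks e g (e ⟨j, x⟩) = e ⟨j, g j x⟩ := by
  simp [ofBlocks]

theorem ofBlocks_injective (e : (Σ j, Ω j) ≃ α) : Function.Injective (ofBlocks e) :=
  e.permCongrHom.injective.comp sigmaCongrRightHom_injective

theorem conj_ofBlocks (e : (Σ j, Ω j) ≃ α) (s : Perm α) (g : ∀ j, Perm (Ω j)) :
    s * ofBlocks e g * s⁻¹ = ofBlocks (e.trans s) g := by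
  ext x
  obtain ⟨⟨j, y⟩, rfl⟩ := (e.trans s).surjective x
  rw [ofBlocks_apply]
  simp

variable [DecidableEq ι] [Fintype ι] [∀ j, DecidableEq (Ω j)] [∀ j, Fintype (Ω j)]
  [DecidableEq α] [Fintype α]

theorem sign_ofBlocks (e : (Σ j, Ω j) ≃ α) (g : ∀ j, Perm (Ω j)) :
    sign (ofBlocks e g) = ∏ j, sign (g j) := by
  let φ : (∀ j, Perm (Ω j)) →* ℤˣ :=
    { toFun g := ∏ j, sign (g j)
      map_one' := by simp
      map_mul' := by simp [Finset.prod_mul_distrib] }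
  have h : sign.comp (ofBlocks e) = φ := by
    -- Both sides are homomorphisms, so tuples with a single nontrivial component suffice.
    refine MonoidHom.pi_ext fun j s => ?_
    have h1 : φ (Pi.mulSingle j s) = sign s := by
      refine (Finset.prod_eq_single j (fun i _ hi => ?_) (by simp)).trans ?_
      · rw [Pi.mulSingle_eq_of_ne hi, sign_one]
      · rw [Pi.mulSingle_eq_same]
    have h2 : ofBlocks e (Pi.mulSingle j s) =
        s.viaFintypeEmbedding ((Function.Embedding.sigmaMk j).trans e.toEmbedding) := by
      ext x
      obtain ⟨⟨l, y⟩, rfl⟩ := e.surjective x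
      rw [ofBlocks_apply]
      rcases eq_or_ne l j with rfl | hl
      · rw [Pi.mulSingle_eq_same]
        exact (viaFintypeEmbedding_apply_image s
          ((Function.Embedding.sigmaMk l).trans e.toEmbedding) y).symm
      · rw [viaFintypeEmbedding_apply_notMem_range]
        · simp [Pi.mulSingle_eq_of_ne hl]
        · rintro ⟨z, hz⟩
          have := congrArg Sigma.fst (e.injective hz)
          exact hl this.symm
    rw [h1, MonoidHom.comp_apply, h2, viaFintypeEmbedding_sign]
  exact DFunLike.congr_fun h g

end Blocks

/-! ### Transpositions in Sylow 2-subgroups of symmetric groups -/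

section TwoGroup

/-- A Sylow `2`-subgroup of the symmetric group on `2 ^ k` points is transitive. -/
theorem exists_mem_sylow_apply_eq {α : Type*} [Finite α] {k : ℕ} (hα : Nat.card α = 2 ^ k) (Q : Sylow 2 (Perm α))
    (x y : α) : ∃ q ∈ Q, q x = y := by
  -- The regular action of the cyclic group of order 2^k is a transitive 2-group; a Sylow subgroup
  -- containing it is conjugate to `Q`.
  let e : α ≃ Multiplicative (ZMod (2 ^ k)) :=
    (Finite.equivFinOfCardEq hα).trans
      ((Finite.equivFinOfCardEq (Nat.card_zmod _)).symm.trans Multiplicative.ofAdd)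
  let f : Multiplicative (ZMod (2 ^ k)) →* Perm α :=
    e.symm.permCongrHom.toMonoidHom.comp (MulAction.toPermHom _ _)
  have hp : IsPGroup 2 f.range := by
    refine IsPGroup.of_surjective (IsPGroup.of_card (n := k) ?_) _ f.rangeRestrict_surjective
    rw [Nat.card_congr Multiplicative.toAdd, Nat.card_zmod]
  obtain ⟨R, hR⟩ := hp.exists_le_sylow
  obtain ⟨g, rfl⟩ := MulAction.exists_smul_eq (Perm α) R Q
  refine ⟨MulAut.conj g (f (e (g⁻¹ y) * (e (g⁻¹ x))⁻¹)),
    Subgroup.smul_mem_pointwise_smul _ (MulAut.conj g) (R : Subgroup (Perm α)) (hR ⟨_, rfl⟩), ?_⟩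
  simp [f]

variable {α : Type*} [DecidableEq α] [Finite α]

/-- Two distinct transpositions sharing a point have a product of order 3, so the transpositions in
a 2-group are pairwise disjoint. -/
theorem eq_of_swap_mem_of_swap_mem {Q : Subgroup (Perm α)} (hQ : IsPGroup 2 Q) {x y z : α}
    (hxy : x ≠ y) (hxz : x ≠ z) (hy : swap x y ∈ Q) (hz : swap x z ∈ Q) : y = z := by
  by_contra hyz
  have := Fintype.ofFinite α
  have h3 : orderOf (swap x y * swap x z) = 3 :=
    (isThreeCycle_swap_mul_swap_same hxy hxz hyz).orderOf
  obtain ⟨a, ha⟩ := IsPGroup.iff_orderOf.mp hQ ⟨_, Q.mul_mem hy hz⟩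
  rw [Subgroup.orderOf_mk, h3] at ha
  rcases a with _ | a
  · omega
  · rw [pow_succ] at ha
    omega

/-- A Sylow `2`-subgroup of a symmetric group contains a transposition. -/
theorem exists_swap_mem_sylow [Nontrivial α] (Q : Sylow 2 (Perm α)) :
    ∃ a b : α, a ≠ b ∧ swap a b ∈ Q := by
  obtain ⟨a, b, hab⟩ := exists_pair_ne α
  have hp : IsPGroup 2 (Subgroup.zpowers (swap a b)) := by
    refine IsPGroup.of_card (n := 1) ?_
    rw [Nat.card_zpowers, (IsSwap.orderOf ⟨a, b, hab, rfl⟩), pow_one]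
  obtain ⟨R, hR⟩ := hp.exists_le_sylow
  obtain ⟨g, rfl⟩ := MulAction.exists_smul_eq (Perm α) R Q
  refine ⟨g a, g b, g.injective.ne hab, ?_⟩
  rw [swap_apply_apply]
  exact Subgroup.smul_mem_pointwise_smul _ (MulAut.conj g) (R : Subgroup (Perm α))
    (hR (Subgroup.mem_zpowers _))

theorem exists_swap_mem_sylow_of_apply [Nontrivial α] {k : ℕ} (hα : Nat.card α = 2 ^ k)
    (Q : Sylow 2 (Perm α)) (x : α) : ∃ y, x ≠ y ∧ swap x y ∈ Q := by
  obtain ⟨a, b, hab, hs⟩ := exists_swap_mem_sylow Q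
  obtain ⟨q, hq, rfl⟩ := exists_mem_sylow_apply_eq hα Q a x
  refine ⟨q b, q.injective.ne hab, ?_⟩
  rw [swap_apply_apply]
  exact Q.mul_mem (Q.mul_mem hq hs) (Q.inv_mem hq)

/-- By transitivity every point is moved by a transposition in `Q`, and these are disjoint; at least
8 points leave room for three of them. -/
theorem exists_three_swaps_mem_sylow {k : ℕ} (hk : 2 < k) (hα : Nat.card α = 2 ^ k)
    (Q : Sylow 2 (Perm α)) (x : α) : ∃ y z w u v : α, [x, y, z, w, u, v].Nodup ∧
      swap x y ∈ Q ∧ swap z w ∈ Q ∧ swap u v ∈ Q := by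
  classical
  have := Fintype.ofFinite α
  rw [Nat.card_eq_fintype_card] at hα
  have h8 : 2 ^ 3 ≤ Fintype.card α := hα ▸ Nat.pow_le_pow_right two_pos hk
  have : Nontrivial α := Fintype.one_lt_card_iff_nontrivial.mp (by omega)
  have hsw := exists_swap_mem_sylow_of_apply (Nat.card_eq_fintype_card.trans hα) Q
  have huniq : ∀ {x y z : α}, x ≠ y → x ≠ z → swap x y ∈ Q → swap x z ∈ Q → y = z :=
    eq_of_swap_mem_of_swap_mem Q.isPGroup'
  have hex : ∀ s : Finset α, s.card < 8 → ∃ z, z ∉ s := fun s hs => by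
    by_contra! h
    have := Finset.card_le_card (fun z _ => h z : (Finset.univ : Finset α) ⊆ s)
    rw [Finset.card_univ] at this
    omega
  obtain ⟨y, hxy, sy⟩ := hsw x
  obtain ⟨z, hz⟩ := hex {x, y} (Finset.card_le_two.trans_lt (by norm_num))
  obtain ⟨w, hzw, sw⟩ := hsw z
  obtain ⟨u, hu⟩ := hex {x, y, z, w} (Finset.card_le_four.trans_lt (by norm_num))
  obtain ⟨v, huv, sv⟩ := hsw u
  simp only [Finset.mem_insert, Finset.mem_singleton, not_or] at hz hu
  refine ⟨y, z, w, u, v, ?_, sy, sw, sv⟩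
  have hnot : ∀ {a b c d : α}, a ≠ b → c ≠ d → swap a b ∈ Q → swap c d ∈ Q →
      c ≠ a → c ≠ b → a ≠ d ∧ b ≠ d := by
    intro a b c d hab hcd hs ht hca hcb
    refine ⟨?_, ?_⟩
    · rintro rfl
      exact hcb (huniq hcd.symm hab (swap_comm c a ▸ ht) hs)
    · rintro rfl
      exact hca (huniq hcd.symm hab.symm (swap_comm c b ▸ ht) (swap_comm a b ▸ hs))
  have h1 := hnot hxy hzw sy sw hz.1 hz.2
  have h2 := hnot hxy huv sy sv hu.1 hu.2.1
  have h3 := hnot hzw huv sw sv hu.2.2.1 hu.2.2.2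
  simp only [List.nodup_cons, List.mem_cons, List.not_mem_nil, or_false, not_or, not_false_eq_true,
    List.nodup_nil, and_true]
  grind

/-- In a symmetric group on `2 ^ k` points with `2 < k`, a permutation commuting with the even
elements of a Sylow `2`-subgroup commutes with the whole subgroup. -/
theorem commute_of_forall_even_commute [Fintype α] {k : ℕ} (hk : 2 < k) (hα : Nat.card α = 2 ^ k)
    (Q : Sylow 2 (Perm α)) {c : Perm α} (hc : ∀ q ∈ Q, sign q = 1 → Commute q c)
    {q : Perm α} (hq : q ∈ Q) : Commute q c := by
  have : Nonempty α := (Nat.card_pos_iff.mp (hα ▸ by positivity)).1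
  obtain ⟨x, y, z, w, u, v, hnd, sy, sw, sv⟩ :
      ∃ x y z w u v : α, [x, y, z, w, u, v].Nodup ∧ swap x y ∈ Q ∧ swap z w ∈ Q ∧ swap u v ∈ Q :=
    ⟨_, exists_three_swaps_mem_sylow hk hα Q (Classical.arbitrary α)⟩
  simp only [List.nodup_cons, List.mem_cons, List.not_mem_nil, or_false, not_or, not_false_eq_true,
    List.nodup_nil, and_true] at hnd
  obtain ⟨⟨hxy, hxz, hxw, hxu, hxv⟩, ⟨hyz, hyw, hyu, hyv⟩, ⟨hzw, hzu, hzv⟩, ⟨hwu, hwv⟩, huv⟩ := hnd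
  have h1 : Commute (swap x y * swap z w) c :=
    hc _ (Q.mul_mem sy sw) (by simp [hxy, hzw])
  have h2 : Commute (swap x y * swap u v) c :=
    hc _ (Q.mul_mem sy sv) (by simp [hxy, huv])
  -- `c` preserves the support of each of the two products, hence their common part {x, y}.
  have hmem : ∀ a b, a ≠ b → swap z w a = a → swap u v a = a → swap x y a = b → c a = x ∨ c a = y := by
    intro a b hab hz hu hb
    have e1 : (swap x y * swap z w) (c a) = c b := by
      rw [← mul_apply, h1.eq, mul_apply, mul_apply, hz, hb]
    have e2 : (swap x y * swap u v) (c a) = c b := by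
      rw [← mul_apply, h2.eq, mul_apply, mul_apply, hu, hb]
    have hne : c a ≠ c b := c.injective.ne hab
    by_contra! h
    rcases eq_or_ne (swap z w (c a)) (c a) with h' | h'
    · rw [mul_apply, h', swap_apply_of_ne_of_ne h.1 h.2] at e1
      exact hne e1
    · rcases eq_or_ne (swap u v (c a)) (c a) with h'' | h''
      · rw [mul_apply, h'', swap_apply_of_ne_of_ne h.1 h.2] at e2
        exact hne e2
      · rw [swap_apply_ne_self_iff] at h' h''
        grind
  have hx := hmem x y hxy (swap_apply_of_ne_of_ne hxz hxw) (swap_apply_of_ne_of_ne hxu hxv)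
    (swap_apply_left x y)
  have hy := hmem y x (Ne.symm hxy) (swap_apply_of_ne_of_ne hyz hyw) (swap_apply_of_ne_of_ne hyu hyv)
    (swap_apply_right x y)
  have ht : Commute (swap x y) c := by
    have hcs : swap (c x) (c y) = swap x y := by
      have hne := c.injective.ne hxy
      rcases hx with hx | hx <;> rcases hy with hy | hy <;> rw [hx, hy] at hne ⊢
      · exact absurd rfl hne
      · exact swap_comm _ _
      · exact absurd rfl hne
    rw [swap_apply_apply, mul_inv_eq_iff_eq_mul] at hcs
    exact hcs.symm
  rcases Int.units_eq_one_or (sign q) with h | h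
  · exact hc q hq h
  -- An odd `q` becomes even after multiplication by the transposition, which commutes with `c`.
  · have := (hc (q * swap x y) (Q.mul_mem hq sy) (by simp [hxy, h])).mul_left ht
    rwa [mul_assoc, swap_mul_self, mul_one] at this

end TwoGroup

end Equiv.Perm

/-! ### Sylow subgroups of normal subgroups and of symmetric groups -/

open Equiv.Perm
open Equiv (Perm swap swap_apply_of_ne_of_ne)

/-- The intersection of a Sylow `p`-subgroup with a normal subgroup has index prime to `p`. -/
theorem Sylow.not_dvd_index_subgroupOf {p : ℕ} [Fact p.Prime] {G : Type*} [Group G] [Finite G]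
    (Q : Sylow p G) (N : Subgroup G) [N.Normal] :
    ¬ p ∣ ((Q : Subgroup G).subgroupOf N).index := fun h => by
  -- By the second isomorphism theorem [N : Q ∩ N] = [QN : Q], which divides [G : Q].
  refine Q.not_dvd_index (h.trans ⟨((Q : Subgroup G) ⊔ N).index, ?_⟩)
  change _ = (Q : Subgroup G).relIndex N * _
  have hN : N.relIndex (Q ⊔ N) * ((Q : Subgroup G) ⊔ N).index = N.index :=
    Subgroup.relIndex_mul_index le_sup_right
  have hQ : ((Q : Subgroup G) ⊓ N).relIndex Q * (Q : Subgroup G).index = ((Q : Subgroup G) ⊓ N).index :=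
    Subgroup.relIndex_mul_index inf_le_left
  have hQN : ((Q : Subgroup G) ⊓ N).relIndex N * N.index = ((Q : Subgroup G) ⊓ N).index :=
    Subgroup.relIndex_mul_index inf_le_right
  rw [Subgroup.inf_relIndex_left] at hQ
  rw [Subgroup.inf_relIndex_right, ← hQ, ← hN, Subgroup.relIndex_sup_right, mul_left_comm] at hQN
  have : N.relIndex Q ≠ 0 := (N.subgroupOf (Q : Subgroup G)).index_ne_zero_of_finite
  exact (Nat.eq_of_mul_eq_mul_left (Nat.pos_of_ne_zero this) hQN).symm

/-- Extend `P` to a Sylow subgroup `S` of `G`: then S ∩ N is a p-group containing `P`, so maximality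
gives equality. -/
theorem Sylow.exists_map_subtype_eq_inf {p : ℕ} [Fact p.Prime] {G : Type*} [Group G]
    {N : Subgroup G} (P : Sylow p N) :
    ∃ S : Sylow p G, (P : Subgroup N).map N.subtype = (S : Subgroup G) ⊓ N := by
  obtain ⟨S, hS⟩ := (P.isPGroup'.map N.subtype).exists_le_sylow
  refine ⟨S, ?_⟩
  have hP : (S : Subgroup G).subgroupOf N = P :=
    P.is_maximal' (S.isPGroup'.comap_of_injective N.subtype N.subtype_injective)
      (Subgroup.map_le_iff_le_comap.mp hS)
  rw [← hP, Subgroup.subgroupOf_map_subtype]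

theorem Subgroup.mem_map_center_subtype {G : Type*} [Group G] (H : Subgroup G) {x : G} :
    x ∈ (Subgroup.center H).map H.subtype ↔ x ∈ H ∧ ∀ y ∈ H, Commute y x := by
  simp only [Subgroup.mem_map, Subgroup.mem_center_iff, Subtype.exists, Subtype.forall]
  constructor
  · rintro ⟨y, hy, h, rfl⟩
    exact ⟨hy, fun z hz => congrArg Subtype.val (h z hz)⟩
  · rintro ⟨hx, h⟩
    exact ⟨x, hx, fun z hz => Subtype.ext (h z hz), rfl⟩

/-- A Sylow `2`-subgroup of the symmetric group on `∑ j, 2 ^ k j` points, the `k j` being distinct,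
is the product of prescribed Sylow `2`-subgroups of symmetric groups on `2 ^ k j` points. -/
theorem Sylow.exists_eq_map_ofBlocks {ι : Type*} [Fintype ι] {k : ι → ℕ}
    (hk : Function.Injective k) {α : Type*} [Finite α] (hα : Nat.card α = ∑ j, 2 ^ k j)
    (Q : ∀ j, Sylow 2 (Perm (Fin (2 ^ k j)))) (S : Sylow 2 (Perm α)) :
    ∃ e : (Σ j, Fin (2 ^ k j)) ≃ α, (S : Subgroup (Perm α)) =
      (Subgroup.pi Set.univ fun j => (Q j : Subgroup (Perm (Fin (2 ^ k j))))).map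
        (ofBlocks e) := by
  classical
  have := Fintype.ofFinite α
  obtain ⟨e⟩ : Nonempty ((Σ j, Fin (2 ^ k j)) ≃ α) := by
    rw [← Fintype.card_eq, ← Nat.card_eq_fintype_card (α := α), hα]
    simp
  -- For any partition `e` the product has Sylow order; conjugating it onto `S` only relabels the
  -- points of the blocks.
  have hcard : Nat.card ((Subgroup.pi Set.univ fun j =>
      (Q j : Subgroup (Perm (Fin (2 ^ k j))))).map (ofBlocks e)) =
      2 ^ (Nat.card (Perm α)).factorization 2 := by
    rw [Subgroup.card_map_of_injective (ofBlocks_injective e)]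
    have : Nat.card (Subgroup.pi Set.univ fun j => (Q j : Subgroup (Perm (Fin (2 ^ k j))))) =
        ∏ j, Nat.card (Q j) := by
      rw [← Nat.card_pi]
      exact Nat.card_congr
        { toFun f j := ⟨f.1 j, f.2 j trivial⟩
          invFun f := ⟨fun j => f j, fun j _ => (f j).2⟩
          left_inv _ := rfl
          right_inv _ := rfl }
    rw [this, Finset.prod_congr rfl fun j _ => (Q j).card_eq_multiplicity, Finset.prod_pow_eq_pow_sum,
      Nat.card_perm, hα]
    have h := padicValNat_two_factorial_sum_two_pow (Finset.univ.map ⟨k, hk⟩)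
    simp only [Finset.sum_map, Function.Embedding.coeFn_mk] at h
    simp only [Nat.card_perm, Nat.card_fin, Nat.factorization_def _ Nat.prime_two, h]
  obtain ⟨s, hs⟩ := MulAction.exists_smul_eq (Perm α) (Sylow.ofCard _ hcard) S
  refine ⟨e.trans s, ?_⟩
  rw [← hs]
  ext x
  simp only [Subgroup.mem_map]
  constructor
  · rintro ⟨_, ⟨g, hg, rfl⟩, rfl⟩
    exact ⟨g, hg, (conj_ofBlocks e s g).symm⟩
  · rintro ⟨g, hg, rfl⟩
    exact ⟨_, ⟨g, hg, rfl⟩, conj_ofBlocks e s g⟩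

namespace Equiv.Perm

/-! ### Blocks as subsets -/

section Blocks

variable {ι α : Type*} {Ω : ι → Type*}

/-- The block of index `i` of a partition `e` of `α`. -/
def block [∀ j, Fintype (Ω j)] (e : (Σ j, Ω j) ≃ α) (i : ι) : Finset α :=
  Finset.univ.map ((Function.Embedding.sigmaMk i).trans e.toEmbedding)

section

variable [∀ j, Fintype (Ω j)] (e : (Σ j, Ω j) ≃ α) {i j : ι}

@[simp]
theorem apply_mem_block {x : Ω j} : e ⟨j, x⟩ ∈ block e i ↔ j = i := by
  simp only [block, Finset.mem_map, Finset.mem_univ, true_and, Function.Embedding.trans_apply,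
    Function.Embedding.sigmaMk_apply, Equiv.coe_toEmbedding, e.apply_eq_iff_eq]
  constructor
  · rintro ⟨y, hy⟩
    exact (congrArg Sigma.fst hy).symm
  · rintro rfl
    exact ⟨x, rfl⟩

theorem card_block (i : ι) : (block e i).card = Fintype.card (Ω i) := by
  simp [block]

/-- The identification of the `i`-th part with the block of index `i`. -/
noncomputable def equivBlock (i : ι) : Ω i ≃ block e i :=
  Equiv.ofBijective (fun x => ⟨e ⟨i, x⟩, (apply_mem_block e).mpr rfl⟩) <| by
    constructor
    · intro x y h
      simpa using h
    · rintro ⟨a, ha⟩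
      obtain ⟨⟨j, x⟩, rfl⟩ := e.surjective a
      obtain rfl := (apply_mem_block e).mp ha
      exact ⟨x, rfl⟩

@[simp]
theorem coe_equivBlock (x : Ω i) : (equivBlock e i x : α) = e ⟨i, x⟩ := rfl

theorem ofSubtype_permCongr_equivBlock [DecidableEq ι] [DecidableEq α] (s : Perm (Ω i)) :
    ofSubtype ((equivBlock e i).permCongr s) = ofBlocks e (Pi.mulSingle i s) := by
  ext a
  obtain ⟨⟨j, x⟩, rfl⟩ := e.surjective a
  rw [ofBlocks_apply]
  rcases eq_or_ne j i with rfl | hj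
  · rw [← coe_equivBlock, ofSubtype_apply_coe]
    simp
  · rw [ofSubtype_apply_of_not_mem _ (by simpa using hj), Pi.mulSingle_eq_of_ne hj, one_apply]

end

end Blocks

end Equiv.Perm

/-! ### Orbits, block subgroups and centralizers in P -/

section Main

variable {ι : Type*} [DecidableEq ι] {k : ι → ℕ} {α : Type*} [Fintype α]
  [DecidableEq α] {i : ι} (hi : 2 < k i) {P : Subgroup (alternatingGroup α)}
  {Q : ∀ j, Sylow 2 (Perm (Fin (2 ^ k j)))} {e : (Σ j, Fin (2 ^ k j)) ≃ α}
  (hP : ∀ σ : alternatingGroup α, σ ∈ P ↔ ∃ q : ∀ j, Perm (Fin (2 ^ k j)),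
    (∀ j, q j ∈ Q j) ∧ ofBlocks e q = σ)

include hi hP

/-- The orbits of a Sylow `2`-subgroup of an alternating group are the blocks. -/
theorem orbit_eq_block (j : ι) (x : Fin (2 ^ k j)) :
    MulAction.orbit P (e ⟨j, x⟩) = (block e j : Set α) := by
  ext a
  constructor
  · rintro ⟨⟨σ, hσ⟩, rfl⟩
    obtain ⟨q, -, hq⟩ := (hP σ).mp hσ
    change (σ : Perm α) (e ⟨j, x⟩) ∈ _
    rw [← hq, ofBlocks_apply, Finset.mem_coe, apply_mem_block]
  · intro ha
    obtain ⟨⟨l, y⟩, rfl⟩ := e.surjective a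
    obtain rfl := (apply_mem_block e).mp ha
    obtain ⟨q, hq, rfl⟩ := exists_mem_sylow_apply_eq (Nat.card_fin _) (Q l) x y
    have hmem : ∀ (j : ι) {s : Perm (Fin (2 ^ k j))}, s ∈ Q j → ∀ a,
        (Pi.mulSingle j s : ∀ j, Perm (Fin (2 ^ k j))) a ∈ Q a := by
      intro j s hs a
      rcases eq_or_ne a j with rfl | h
      · rwa [Pi.mulSingle_eq_same]
      · rw [Pi.mulSingle_eq_of_ne h]
        exact one_mem _
    -- An odd element fixing the point, used to correct parity. It is a transposition in block `i`,
    -- where k_i > 2 leaves one avoiding the point even when l = i.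
    obtain ⟨t, ht, hodd, hfix⟩ : ∃ t : ∀ j, Perm (Fin (2 ^ k j)), (∀ j, t j ∈ Q j) ∧
        sign (ofBlocks e t) = -1 ∧ ofBlocks e t (e ⟨l, x⟩) = e ⟨l, x⟩ := by
      obtain ⟨z, w, hzw, hs, hz⟩ : ∃ z w : Fin (2 ^ k i), z ≠ w ∧ swap z w ∈ Q i ∧
          ∀ h : l = i, swap z w (h ▸ x) = h ▸ x := by
        by_cases h : l = i
        · subst h
          obtain ⟨y, z, w, u, v, hnd, -, hs, -⟩ :=
            exists_three_swaps_mem_sylow hi (Nat.card_fin _) (Q l) x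
          simp only [List.nodup_cons, List.mem_cons, not_or] at hnd
          exact ⟨z, w, hnd.2.2.1.1, hs, fun _ =>
            swap_apply_of_ne_of_ne hnd.1.2.1 hnd.1.2.2.1⟩
        · have : Nontrivial (Fin (2 ^ k i)) :=
            Fin.nontrivial_iff_two_le.mpr (Nat.le_self_pow (by omega) 2)
          obtain ⟨z, w, hzw, hs⟩ := exists_swap_mem_sylow (Q i)
          exact ⟨z, w, hzw, hs, fun h' => absurd h' h⟩
      refine ⟨Pi.mulSingle i (swap z w), hmem i hs, ?_, ?_⟩
      · rw [← ofSubtype_permCongr_equivBlock, sign_ofSubtype, sign_permCongr, sign_swap hzw]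
      · rw [ofBlocks_apply]
        by_cases h : l = i
        · subst h
          rw [Pi.mulSingle_eq_same, hz rfl]
        · rw [Pi.mulSingle_eq_of_ne h, one_apply]
    have key : ∀ r : ∀ j, Perm (Fin (2 ^ k j)), (∀ j, r j ∈ Q j) → sign (ofBlocks e r) = 1 →
        ofBlocks e r (e ⟨l, x⟩) ∈ MulAction.orbit P (e ⟨l, x⟩) := fun r hr hs =>
      ⟨⟨⟨ofBlocks e r, hs⟩, (hP _).mpr ⟨r, hr, rfl⟩⟩, rfl⟩
    have hqx : ofBlocks e (Pi.mulSingle l q) (e ⟨l, x⟩) = e ⟨l, q x⟩ := by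
      rw [ofBlocks_apply, Pi.mulSingle_eq_same]
    rw [← hqx]
    rcases Int.units_eq_one_or (sign (ofBlocks e (Pi.mulSingle l q))) with h | h
    · exact key _ (hmem l hq) h
    · have := key (Pi.mulSingle l q * t) (fun a => mul_mem (hmem l hq a) (ht a))
        (by rw [map_mul, map_mul, h, hodd]; rfl)
      rwa [map_mul, mul_apply, hfix] at this

omit hi in
/-- The elements of `P` supported on a block form a Sylow `2`-subgroup of its alternating group. -/
theorem comap_ofSubtype_eq_sylow (hP2 : IsPGroup 2 P) :
    ∃ U : Sylow 2 (alternatingGroup (block e i)),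
      (U : Subgroup _) = P.comap (alternatingGroup.ofSubtype (block e i)) ∧
      ∀ c : Perm α, (∀ u ∈ U, Commute (ofSubtype (u : Perm (block e i))) c) ↔
        ∀ s ∈ Q i, sign s = 1 → Commute (ofBlocks e (Pi.mulSingle i s)) c := by
  let φ := Equiv.altCongrHom (equivBlock e i)
  have hφ : ∀ s : alternatingGroup (Fin (2 ^ k i)),
      ofSubtype (φ s : Perm (block e i)) = ofBlocks e (Pi.mulSingle i (s : Perm (Fin (2 ^ k i)))) :=
    fun s => ofSubtype_permCongr_equivBlock e _
  have hmem : ∀ s : alternatingGroup (Fin (2 ^ k i)),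
      φ s ∈ P.comap (alternatingGroup.ofSubtype (block e i)) ↔ (s : Perm _) ∈ Q i := by
    intro s
    rw [Subgroup.mem_comap, hP, alternatingGroup.coe_ofSubtype, hφ]
    constructor
    · rintro ⟨q, hq, h⟩
      rw [(ofBlocks_injective e h : q = _)] at hq
      simpa using hq i
    · refine fun hs => ⟨_, fun a => ?_, rfl⟩
      rcases eq_or_ne a i with rfl | h
      · rwa [Pi.mulSingle_eq_same]
      · rw [Pi.mulSingle_eq_of_ne h]
        exact one_mem _
  have hp : IsPGroup 2 (P.comap (alternatingGroup.ofSubtype (block e i))) :=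
    hP2.comap_of_injective _ alternatingGroup.ofSubtype_injective
  have hindex : ¬ 2 ∣ (P.comap (alternatingGroup.ofSubtype (block e i))).index := by
    rw [← Subgroup.index_comap_of_surjective _ (f := φ.toMonoidHom) φ.surjective]
    -- Transported to `Fin (2 ^ k i)`, the subgroup is the even part of `Q i`, whose index is odd
    -- because the alternating group is normal.
    convert (Q i).not_dvd_index_subgroupOf (alternatingGroup (Fin (2 ^ k i))) using 3
    ext s
    exact hmem s
  refine ⟨hp.toSylow hindex, rfl, fun c => ⟨fun h s hs hs1 => ?_, fun h u hu => ?_⟩⟩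
  · rw [← hφ ⟨s, hs1⟩]
    exact h _ ((hmem _).mpr hs)
  · obtain ⟨s, rfl⟩ := φ.surjective u
    rw [hφ]
    exact h s ((hmem s).mp hu) s.2

/-- Both groups embed in `Perm α`, and their images coincide. Of `U`, only its commutation criterion
`hU` matters. -/
theorem centralizer_equiv_evenSubdirectProduct [Fintype ι]
    {U : Subgroup (alternatingGroup (block e i))}
    (hU : ∀ c : Perm α, (∀ u ∈ U, Commute (ofSubtype (u : Perm (block e i))) c) ↔
        ∀ s ∈ Q i, sign s = 1 → Commute (ofBlocks e (Pi.mulSingle i s)) c) :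
    Nonempty ((P ⊓ Subgroup.centralizer (U.map (alternatingGroup.ofSubtype (block e i)) :
        Set (alternatingGroup α)) : Subgroup (alternatingGroup α)) ≃*
      evenSubdirectProduct (Function.update
        (fun j => (Q j : Subgroup (Perm (Fin (2 ^ k j))))) i
        ((Subgroup.center (Q i)).map (Q i : Subgroup (Perm (Fin (2 ^ k i)))).subtype))) := by
  set H := Function.update (fun j => (Q j : Subgroup (Perm (Fin (2 ^ k j))))) i
    ((Subgroup.center (Q i)).map (Q i : Subgroup (Perm (Fin (2 ^ k i)))).subtype) with hHdef
  have hH : ∀ q : ∀ j, Perm (Fin (2 ^ k j)), (∀ j, q j ∈ H j) ↔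
      (∀ j, q j ∈ Q j) ∧ ∀ s ∈ Q i, Commute s (q i) := by
    intro q
    rw [hHdef, Function.forall_update_iff _ (fun j (K : Subgroup (Perm (Fin (2 ^ k j)))) => q j ∈ K),
      Subgroup.mem_map_center_subtype]
    constructor
    · rintro ⟨⟨h1, h2⟩, h3⟩
      refine ⟨fun j => ?_, h2⟩
      rcases eq_or_ne j i with rfl | h
      · exact h1
      · exact h3 j h
    · rintro ⟨h1, h2⟩
      exact ⟨⟨h1 i, h2⟩, fun j _ => h1 j⟩
  let incl : (∀ j, H j) →* ∀ j, Perm (Fin (2 ^ k j)) :=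
    { toFun g j := g j
      map_one' := rfl
      map_mul' _ _ := rfl }
  have hincl : Function.Injective ((ofBlocks e).comp incl) :=
    (ofBlocks_injective e).comp fun g h hgh => funext fun j => Subtype.ext (congrFun hgh j)
  have hcent : ∀ q : ∀ j, Perm (Fin (2 ^ k j)),
      (∀ u ∈ U, Commute (ofSubtype (u : Perm (block e i))) (ofBlocks e q)) ↔
        ∀ s ∈ Q i, Commute s (q i) := by
    intro q
    rw [hU]
    have hc : ∀ s : Perm (Fin (2 ^ k i)),
        Commute (ofBlocks e (Pi.mulSingle i s)) (ofBlocks e q) ↔ Commute s (q i) := by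
      intro s
      rw [commute_iff_eq, commute_iff_eq, ← map_mul, ← map_mul, (ofBlocks_injective e).eq_iff]
      constructor
      · intro h
        simpa using congrFun h i
      · intro h
        funext j
        rcases eq_or_ne j i with rfl | hj
        · simpa using h
        · simp [Pi.mulSingle_eq_of_ne hj]
    simp only [hc]
    exact ⟨fun h s hs => commute_of_forall_even_commute hi (Nat.card_fin _) (Q i) h hs,
      fun h s hs _ => h s hs⟩
  have himage : (P ⊓ Subgroup.centralizer (U.map (alternatingGroup.ofSubtype (block e i)) :
        Set (alternatingGroup α))).map (alternatingGroup α).subtype =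
      (evenSubdirectProduct H).map ((ofBlocks e).comp incl) := by
    ext c
    simp only [Subgroup.mem_map, Subgroup.mem_inf, Subgroup.mem_centralizer_iff]
    constructor
    · rintro ⟨σ, ⟨hσ, hσc⟩, rfl⟩
      obtain ⟨q, hq, hqσ⟩ := (hP σ).mp hσ
      have h := (hH q).mpr ⟨hq, (hcent q).mp fun u hu => by
        rw [hqσ]
        exact congrArg Subtype.val (hσc _ (Subgroup.mem_map_of_mem _ hu))⟩
      refine ⟨fun j => ⟨q j, h j⟩, ?_, hqσ⟩
      change ∏ j, sign (q j) = 1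
      rw [← sign_ofBlocks e, hqσ]
      exact σ.2
    · rintro ⟨g, hg, rfl⟩
      have hsign : sign (ofBlocks e (incl g)) = 1 := (sign_ofBlocks e _).trans hg
      obtain ⟨h1, h2⟩ := (hH (incl g)).mp fun j => (g j).2
      refine ⟨⟨_, hsign⟩, ⟨(hP _).mpr ⟨_, h1, rfl⟩, ?_⟩, rfl⟩
      rintro _ ⟨u, hu, rfl⟩
      exact Subtype.ext ((hcent _).mpr h2 u hu)
  exact ⟨((Subgroup.equivMapOfInjective _ _ (alternatingGroup α).subtype_injective).trans
    (MulEquiv.subgroupCongr himage)).trans (Subgroup.equivMapOfInjective _ _ hincl).symm⟩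

end Main

/-! ### The main theorem -/

theorem mainTheorem12 (m : ℕ) (k : Fin (m + 1) → ℕ) (hk : StrictMono k)
    (n : ℕ) (hn : n = ∑ j, 2 ^ k j) (i : Fin (m + 1)) (hi : 2 < k i)
    (P : Sylow 2 (alternatingGroup (Fin n)))
    (Q : ∀ j, Sylow 2 (Equiv.Perm (Fin (2 ^ k j)))) :
    (∃! O : Finset (Fin n),
      (∃ x : Fin n, (O : Set (Fin n)) = MulAction.orbit P x) ∧ O.card = 2 ^ k i) ∧
    ∀ O : Finset (Fin n),
      (∃ x : Fin n, (O : Set (Fin n)) = MulAction.orbit P x) → O.card = 2 ^ k i →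
      (∃ T : Sylow 2 (alternatingGroup O),
        (T : Subgroup (alternatingGroup O)).map (alternatingGroup.ofSubtype O) ≤
          (P : Subgroup (alternatingGroup (Fin n)))) ∧
      ∀ T : Sylow 2 (alternatingGroup O),
        (T : Subgroup (alternatingGroup O)).map (alternatingGroup.ofSubtype O) ≤
          (P : Subgroup (alternatingGroup (Fin n))) →
        Nonempty
          (((P : Subgroup (alternatingGroup (Fin n))) ⊓
              Subgroup.centralizer
                ((T : Subgroup (alternatingGroup O)).map (alternatingGroup.ofSubtype O) :
                  Set (alternatingGroup (Fin n))) : Subgroup (alternatingGroup (Fin n))) ≃*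
            evenSubdirectProduct
              (Function.update
                (fun j => (Q j : Subgroup (Equiv.Perm (Fin (2 ^ k j))))) i
                ((Subgroup.center (Q i)).map
                  (Q i : Subgroup (Equiv.Perm (Fin (2 ^ k i)))).subtype))) := by
  obtain ⟨S, hS⟩ := P.exists_map_subtype_eq_inf
  obtain ⟨e, he⟩ := S.exists_eq_map_ofBlocks hk.injective ((Nat.card_fin n).trans hn) Q
  have hP : ∀ σ : alternatingGroup (Fin n), σ ∈ (P : Subgroup (alternatingGroup (Fin n))) ↔
      ∃ q : ∀ j, Perm (Fin (2 ^ k j)), (∀ j, q j ∈ Q j) ∧ ofBlocks e q = σ := by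
    intro σ
    have h : (σ : Perm (Fin n)) ∈ (P : Subgroup (alternatingGroup (Fin n))).map
        (alternatingGroup (Fin n)).subtype ↔ σ ∈ (P : Subgroup (alternatingGroup (Fin n))) :=
      Subgroup.mem_map_iff_mem (alternatingGroup (Fin n)).subtype_injective
    rw [← h, hS, he, Subgroup.mem_inf, and_iff_left σ.2]
    simp only [Subgroup.mem_map, Subgroup.mem_pi, Set.mem_univ, true_imp_iff]
    rfl
  have horbit : ∀ O : Finset (Fin n), (∃ x : Fin n, (O : Set (Fin n)) = MulAction.orbit P x) →
      O.card = 2 ^ k i → O = block e i := by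
    rintro O ⟨x, hx⟩ hO
    obtain ⟨⟨j, y⟩, rfl⟩ := e.surjective x
    rw [show MulAction.orbit P (e ⟨j, y⟩) = _ from orbit_eq_block hi hP j y, Finset.coe_inj] at hx
    subst hx
    rw [card_block, Fintype.card_fin] at hO
    rw [hk.injective (Nat.pow_right_injective le_rfl hO)]
  refine ⟨⟨block e i, ⟨⟨e ⟨i, 0⟩, (orbit_eq_block hi hP i 0).symm⟩, ?_⟩,
    fun O hO => horbit O hO.1 hO.2⟩, fun O hO hcard => ?_⟩
  · rw [card_block, Fintype.card_fin]
  · obtain rfl := horbit O hO hcard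
    obtain ⟨U, hU, hUc⟩ := comap_ofSubtype_eq_sylow (i := i) hP P.isPGroup'
    refine ⟨⟨U, Subgroup.map_le_iff_le_comap.mpr hU.le⟩, fun T hT => ?_⟩
    -- T ≤ P places `T` inside `U`, a 2-group, so the maximality of `T` forces equality.
    have hTU : T = U := Sylow.ext
      (T.is_maximal' U.isPGroup' ((Subgroup.map_le_iff_le_comap.mp hT).trans hU.ge)).symm
    rw [hTU]
    exact centralizer_equiv_evenSubdirectProduct hi hP hUc
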